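/- Let $k\ge 1$, let $U\subset\mathbb C^k$ be open and connected, and either bounded or Kobayashi hyperbolic (its Kobayashi pseudodistance separates points). Let $f:U\to\mathbb C^k$ be a holomorphic open map. Assume that every $q\in\partial U$ has a p.s.h. barrier, i.e. there is a continuous plurisubharmonic function $\rho_q$ on $U$ with $\rho_q<0$ on $U$ and $\lim_{U\ni p\to q}\rho_q(p)=0$. Let $\mathcal C\subset U$ satisfy $f(\mathcal C)\subset\mathcal C$, let $\overline{\mathcal C}$ be the closure of $\mathcal C$ with respect to $U$, and let $V$ be the interior of $\overline{\mathcal C}$. Suppose that either $\overline{\mathcal C}$ itself is, or $\overline{\mathcal C}$ is a countable union of, sets $S\subset U$ that are closed in $U$, satisfy $f(S)\subset S$, and contain a point $x$ whose forward orbit $\{f^n(x):n\ge 0\}$ is dense in $S$. Then $V$ contains no recurrent points: there is no $p_0\in V$ with $f^{n_i}(p_0)\to p_0$ for some sequence $n_i\to+\infty$; moreover, there is no connected component $W$ of $V$ and point $p_0\in W$ such that, for some sequence $n_i\to+\infty$, the set $\{f^{n_i}(p_0)\}_i$ is contained in a compact subset of $W$. -/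

import Mathlib

open Set Filter Topology

noncomputable section

/-- The space `ℂ^k` with its Euclidean norm. -/
abbrev Ck (k : ℕ) : Type := EuclideanSpace ℂ (Fin k)

/-- The Poincaré distance between two points of the unit disc of `ℂ`. -/
def poincareDist (a b : ℂ) : ℝ :=
  2 * Real.artanh (‖a - b‖ / ‖1 - (starRingEnd ℂ) a * b‖)

/-- `KobayashiChain U z w l`: there is a finite chain of holomorphic discs in `U` that joins `z`
to `w` and has total Poincaré length `l`. -/
inductive KobayashiChain {k : ℕ} (U : Set (Ck k)) : Ck k → Ck k → ℝ → Prop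
  | nil (z : Ck k) (hz : z ∈ U) : KobayashiChain U z z 0
  | cons (φ : ℂ → Ck k) (hφ : DifferentiableOn ℂ φ (Metric.ball 0 1))
      (hφU : MapsTo φ (Metric.ball 0 1) U) (a b : ℂ)
      (ha : a ∈ Metric.ball (0 : ℂ) 1) (hb : b ∈ Metric.ball (0 : ℂ) 1)
      (w : Ck k) (l : ℝ) (h : KobayashiChain U (φ b) w l) :
      KobayashiChain U (φ a) w (poincareDist a b + l)

/-- The Kobayashi pseudodistance of `U`: the infimum of the lengths of chains of discs
(`⊤` if there is no chain). -/
def kobayashiEDist {k : ℕ} (U : Set (Ck k)) (z w : Ck k) : ENNReal :=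
  ⨅ (l : ℝ) (_ : KobayashiChain U z w l), ENNReal.ofReal l

/-- `U` is Kobayashi hyperbolic: its Kobayashi pseudodistance separates points. -/
def IsKobayashiHyperbolic {k : ℕ} (U : Set (Ck k)) : Prop :=
  ∀ z ∈ U, ∀ w ∈ U, kobayashiEDist U z w = 0 → z = w

/-- `ρ` is a continuous (real-valued) plurisubharmonic function on `U`: it is continuous on `U`
and satisfies the sub-mean value inequality on every closed complex disc
`{a + ζ b : |ζ| ≤ 1}` contained in `U`. -/
structure IsContinuousPSHOn {k : ℕ} (ρ : Ck k → ℝ) (U : Set (Ck k)) : Prop where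
  continuousOn : ContinuousOn ρ U
  le_circleAverage : ∀ a b : Ck k, (∀ ζ ∈ Metric.closedBall (0 : ℂ) 1, a + ζ • b ∈ U) →
    ρ a ≤ Real.circleAverage (fun ζ : ℂ => ρ (a + ζ • b)) 0 1

/-- The boundary point `q` of `U` has a plurisubharmonic barrier: there is a continuous
plurisubharmonic function on `U` that is negative on `U` and tends to `0` at `q`. (Allowing
the value `-∞` would change nothing: replace `ρ` by `max ρ (-1)`.) -/
def HasPSHBarrier {k : ℕ} (U : Set (Ck k)) (q : Ck k) : Prop :=
  ∃ ρ : Ck k → ℝ, IsContinuousPSHOn ρ U ∧ (∀ p ∈ U, ρ p < 0) ∧ Tendsto ρ (𝓝[U] q) (𝓝 0)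

/-- The closure of `C` with respect to `U`. -/
def relClosure {k : ℕ} (U C : Set (Ck k)) : Set (Ck k) := closure C ∩ U

/-- `S` is a subset of `U`, closed in `U`, with `f(S) ⊆ S`, and the forward orbit
`x, f x, f (f x), …` of some point `x` of `S` is dense in `S`. -/
structure IsClosedInvariantWithDenseOrbit {k : ℕ} (U : Set (Ck k)) (f : Ck k → Ck k)
    (S : Set (Ck k)) : Prop where
  subset : S ⊆ U
  relClosure_eq : relClosure U S = S
  mapsTo : MapsTo f S S
  dense_orbit : ∃ x ∈ S, S ⊆ closure (range fun n : ℕ => f^[n] x)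

/-- `p` is a recurrent point of `f`: some subsequence of its orbit converges to `p`. -/
def IsRecurrentPoint {k : ℕ} (f : Ck k → Ck k) (p : Ck k) : Prop :=
  ∃ φ : ℕ → ℕ, StrictMono φ ∧ Tendsto (fun i => f^[φ i] p) atTop (𝓝 p)

/-- The weaker form of recurrence of a point `p` of `W`: some subsequence of the orbit of `p`
lies in a compact subset of `W`. -/
def IsWeaklyRecurrentIn {k : ℕ} (f : Ck k → Ck k) (W : Set (Ck k)) (p : Ck k) : Prop :=
  ∃ φ : ℕ → ℕ, StrictMono φ ∧ ∃ K : Set (Ck k), IsCompact K ∧ K ⊆ W ∧ ∀ i, f^[φ i] p ∈ K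

end

/-! The interior `V` of the relative closure is shown to be empty. Suppose not. As `f` is open, it
maps `V` into itself. By Baire one of the countably many closed invariant sets has interior in `V`,
and its dense orbit enters that interior at some `y`. Since `ℂ^k` has no isolated points, tails of
the orbit remain dense there, so `y` is recurrent and its orbit closure is a neighbourhood of `y`.

The Kobayashi pseudodistance of `V` is an extended metric inducing the usual topology, and `f` does
not expand it. For an open nonexpanding map of a locally compact space, such an orbit closure is
compact (`LipschitzWith.isCompact_closure_orbit`) and open (`LipschitzWith.isOpen_closure_orbit`). A
nonempty compact open set cannot exist in the connected noncompact space `ℂ^k`. -/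

theorem isOpen_subset_closure_range_shift {X : Type*} [TopologicalSpace X] [T1Space X]
    [∀ x : X, (𝓝[≠] x).NeBot] {O : Set X} (hO : IsOpen O) {u : ℕ → X}
    (h : O ⊆ closure (range u)) (m : ℕ) : O ⊆ closure (range fun j => u (j + m)) := by
  intro z hz
  by_contra hzA
  set A := range fun j => u (j + m)
  have hsub : range u ⊆ u '' Iio m ∪ A := by
    rintro _ ⟨j, rfl⟩
    rcases lt_or_ge j m with hj | hj
    · exact Or.inl ⟨j, hj, rfl⟩
    · exact Or.inr ⟨j - m, by simp [Nat.sub_add_cancel hj]⟩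
  have hfin : (u '' Iio m).Finite := (finite_Iio m).image u
  have hsub' : O ∩ (closure A)ᶜ ⊆ u '' Iio m := by
    rintro w ⟨hwO, hwA⟩
    have hw := closure_mono hsub (h hwO)
    rw [closure_union, hfin.isClosed.closure_eq] at hw
    exact hw.resolve_right hwA
  -- Without isolated points, a nonempty open set cannot be contained in the finite initial piece of
  -- the sequence.
  exact infinite_of_mem_nhds z ((hO.inter isClosed_closure.isOpen_compl).mem_nhds ⟨hz, hzA⟩)
    (hfin.subset hsub')

/-! ### Recurrence for nonexpanding maps -/

section Nonexpanding

variable {X : Type*} [PseudoEMetricSpace X] {f : X → X} {y : X}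

theorem LipschitzWith.edist_iterate_le (hf : LipschitzWith 1 f) (n : ℕ) (a b : X) :
    edist (f^[n] a) (f^[n] b) ≤ edist a b := by
  simpa using hf.iterate n a b

/-- The displacement of a return of `y` bounds the displacement on the orbit closure of `y`. -/
theorem LipschitzWith.edist_iterate_self_le_of_mem_closure_orbit (hf : LipschitzWith 1 f) {z : X}
    (hz : z ∈ closure (range fun n => f^[n] y)) (n : ℕ) :
    edist (f^[n] z) z ≤ edist (f^[n] y) y := by
  have hcl : IsClosed {z | edist (f^[n] z) z ≤ edist (f^[n] y) y} :=
    isClosed_le ((hf.continuous.iterate n).edist continuous_id) continuous_const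
  refine closure_minimal ?_ hcl hz
  rintro _ ⟨j, rfl⟩
  change edist (f^[n] (f^[j] y)) (f^[j] y) ≤ _
  rw [← Function.iterate_add_apply, add_comm, Function.iterate_add_apply]
  exact hf.edist_iterate_le j _ _

/-- One return at time `n + 1` with displacement below `ε / (N + 1)` suffices: repeating it `N + 1`
times adds up displacements to less than `ε` and makes the return late. -/
theorem LipschitzWith.exists_ge_edist_iterate_lt (hf : LipschitzWith 1 f)
    (hrec : y ∈ closure (range fun n => f^[n] (f y))) {ε : ENNReal} (hε : 0 < ε) (N : ℕ) :
    ∃ n, N ≤ n ∧ edist (f^[n] y) y < ε := by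
  have hε' : 0 < ε / (N + 1 : ℕ) := ENNReal.div_pos hε.ne' (ENNReal.natCast_ne_top _)
  obtain ⟨_, ⟨n, rfl⟩, hn⟩ := EMetric.mem_closure_iff.1 hrec _ hε'
  have hn' : edist (f^[n + 1] y) y < ε / (N + 1 : ℕ) := by
    rw [Function.iterate_succ_apply, edist_comm]; exact hn
  have key : ∀ k : ℕ, edist (f^[k * (n + 1)] y) y ≤ k * edist (f^[n + 1] y) y := by
    intro k
    induction k with
    | zero => simp
    | succ k ih =>
      calc edist (f^[(k + 1) * (n + 1)] y) y
          ≤ edist (f^[k * (n + 1)] (f^[n + 1] y)) (f^[k * (n + 1)] y)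
            + edist (f^[k * (n + 1)] y) y := by
            rw [add_mul, one_mul, Function.iterate_add_apply]; exact edist_triangle _ _ _
        _ ≤ edist (f^[n + 1] y) y + k * edist (f^[n + 1] y) y :=
            add_le_add (hf.edist_iterate_le _ _ _) ih
        _ = _ := by push_cast; ring
  refine ⟨(N + 1) * (n + 1), by nlinarith, (key (N + 1)).trans_lt ?_⟩
  rw [mul_comm]
  exact ENNReal.mul_lt_of_lt_div hn'

/-- The orbit closure of a recurrent point of a nonexpanding map is minimal. -/
theorem LipschitzWith.exists_ge_iterate_edist_lt (hf : LipschitzWith 1 f)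
    (hrec : y ∈ closure (range fun n => f^[n] (f y))) {z : X}
    (hz : z ∈ closure (range fun n => f^[n] y)) {ε : ENNReal} (hε : 0 < ε) (N : ℕ) :
    ∃ n, N ≤ n ∧ edist (f^[n] z) y < ε := by
  obtain ⟨_, ⟨j, rfl⟩, hj⟩ := EMetric.mem_closure_iff.1 hz _ (ENNReal.half_pos hε.ne')
  -- From time `j` on, the orbit of `y` is shadowed by that of `z`, so a late return of `y` brings
  -- `z` close to `y` too.
  obtain ⟨n, hn, hny⟩ := hf.exists_ge_edist_iterate_lt hrec (ENNReal.half_pos hε.ne') (N + j)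
  refine ⟨n - j, by omega, ?_⟩
  calc edist (f^[n - j] z) y
      ≤ edist (f^[n - j] z) (f^[n - j] (f^[j] y)) + edist (f^[n - j] (f^[j] y)) y :=
        edist_triangle _ _ _
    _ ≤ edist z (f^[j] y) + edist (f^[n] y) y := by
        gcongr
        · exact hf.edist_iterate_le _ _ _
        · rw [← Function.iterate_add_apply, Nat.sub_add_cancel (by omega)]
    _ < ε / 2 + ε / 2 := ENNReal.add_lt_add hj hny
    _ = ε := ENNReal.add_halves ε

theorem iterate_mem_closure_orbit (hf : Continuous f) {z : X}
    (hz : z ∈ closure (range fun n => f^[n] y)) (m : ℕ) :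
    f^[m] z ∈ closure (range fun n => f^[n] y) := by
  refine map_mem_closure (hf.iterate m) hz ?_
  rintro _ ⟨n, rfl⟩
  exact ⟨m + n, Function.iterate_add_apply f m n y⟩

/-- By minimality every point of `Y ∩ K`, with `K` a compact neighbourhood of `y`, returns to `K`;
by compactness the return times are bounded by some `N`. The orbit then stays in the compact union
of the `f^[j] '' K` with `j ≤ N`. -/
theorem LipschitzWith.isCompact_closure_orbit [T2Space X] [LocallyCompactSpace X]
    (hf : LipschitzWith 1 f) (hrec : y ∈ closure (range fun n => f^[n] (f y))) :
    IsCompact (closure (range fun n => f^[n] y)) := by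
  set Y := closure (range fun n => f^[n] y) with hY
  have hyY : ∀ m, f^[m] y ∈ Y := fun m => subset_closure ⟨m, rfl⟩
  obtain ⟨K, hK, hKy⟩ := exists_compact_mem_nhds y
  obtain ⟨r, hr, hrK⟩ := EMetric.mem_nhds_iff.1 hKy
  have hYK : IsCompact (Y ∩ K) := hK.inter_left isClosed_closure
  obtain ⟨t, ht⟩ := hYK.elim_finite_subcover
    -- The exponent `n + 1` keeps return times positive, so that the induction below advances.
    (fun n : ℕ => {z | edist (f^[n + 1] z) y < r})
    (fun n => isOpen_lt ((hf.continuous.iterate _).edist continuous_const) continuous_const)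
    (by
      rintro z ⟨hz, -⟩
      obtain ⟨n, hn, h⟩ := hf.exists_ge_iterate_edist_lt hrec hz hr 1
      refine mem_iUnion.2 ⟨n - 1, ?_⟩
      simpa [Nat.sub_add_cancel hn] using h)
  obtain ⟨N, hN⟩ := t.exists_nat_subset_range
  have hret : ∀ z ∈ Y ∩ K, ∃ n, 1 ≤ n ∧ n ≤ N ∧ f^[n] z ∈ K := by
    intro z hz
    obtain ⟨n, hn, h⟩ := mem_iUnion₂.1 (ht hz)
    have := Finset.mem_range.1 (hN hn)
    exact ⟨n + 1, by omega, by omega, hrK h⟩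
  have hvisit : ∀ m, ∃ i, i ≤ m ∧ m ≤ i + N ∧ f^[i] y ∈ K := by
    intro m
    induction m with
    | zero => exact ⟨0, le_rfl, Nat.zero_le _, mem_of_mem_nhds hKy⟩
    | succ m ih =>
      obtain ⟨i, him, hmi, hi⟩ := ih
      rcases lt_or_ge m (i + N) with h | h
      · exact ⟨i, by omega, by omega, hi⟩
      · obtain ⟨n, h1, h2, h3⟩ := hret _ ⟨hyY i, hi⟩
        refine ⟨n + i, by omega, by omega, ?_⟩
        rwa [Function.iterate_add_apply]
  have hM : IsCompact (⋃ j ∈ Finset.range (N + 1), f^[j] '' K) :=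
    (Finset.range (N + 1)).isCompact_biUnion fun j _ => hK.image (hf.continuous.iterate j)
  refine hM.of_isClosed_subset isClosed_closure (closure_minimal ?_ hM.isClosed)
  rintro _ ⟨m, rfl⟩
  obtain ⟨i, him, hmi, hi⟩ := hvisit m
  refine mem_iUnion₂.2 ⟨m - i, Finset.mem_range.2 (by omega), f^[i] y, hi, ?_⟩
  rw [← Function.iterate_add_apply, Nat.sub_add_cancel him]

/-- If `f` is open and nonexpanding and the orbit closure of the recurrent point `y` is a
neighbourhood of `y`, then it is open. -/
theorem LipschitzWith.isOpen_closure_orbit [T2Space X] [LocallyCompactSpace X]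
    (hf : LipschitzWith 1 f) (hfo : IsOpenMap f)
    (hrec : y ∈ closure (range fun n => f^[n] (f y)))
    (hy : y ∈ interior (closure (range fun n => f^[n] y))) :
    IsOpen (closure (range fun n => f^[n] y)) := by
  have hc := hf.isCompact_closure_orbit hrec
  set Y := closure (range fun n => f^[n] y) with hY
  have hinv : ∀ z ∈ Y, ∀ m, f^[m] z ∈ Y := fun z hz m =>
    iterate_mem_closure_orbit hf.continuous hz m
  -- The image of the compact set `Y` is closed and contains the orbit of `f y`, hence by recurrence
  -- also `y`.
  have hsurj : ∀ x ∈ Y, ∃ w ∈ Y, f w = x := by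
    have hcl : IsClosed (f '' Y) := (hc.image hf.continuous).isClosed
    have h1 : closure (range fun n => f^[n] (f y)) ⊆ f '' Y := by
      refine closure_minimal ?_ hcl
      rintro _ ⟨n, rfl⟩
      exact ⟨f^[n] y, subset_closure ⟨n, rfl⟩, (Function.Commute.iterate_self f n).eq y |>.symm⟩
    intro x hx
    refine closure_minimal ?_ hcl hx
    rintro _ ⟨n, rfl⟩
    rcases n with _ | n
    · exact h1 hrec
    · exact h1 (subset_closure ⟨n, rfl⟩)
  have hsurj' : ∀ m, ∀ x ∈ Y, ∃ w ∈ Y, f^[m] w = x := by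
    intro m
    induction m with
    | zero => exact fun x hx => ⟨x, hx, rfl⟩
    | succ m ih =>
      intro x hx
      obtain ⟨w, hw, rfl⟩ := hsurj x hx
      obtain ⟨v, hv, rfl⟩ := ih w hw
      exact ⟨v, hv, Function.iterate_succ_apply' f m v⟩
  have hopen : ∀ m, IsOpenMap f^[m] := by
    intro m
    induction m with
    | zero => exact IsOpenMap.id
    | succ m ih => exact ih.comp hfo
  obtain ⟨r, hr, hrY⟩ := EMetric.isOpen_iff.1 isOpen_interior y hy
  rw [isOpen_iff_mem_nhds]
  intro x hx
  -- The orbit of `x` enters the interior of `Y` at time `m`. Choose `n ≥ m` with `f^[n]` nearly the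
  -- identity on `Y`, and pull `x` back by `n - m` steps to `w`. Then `w` is close to `f^[n] w =
  -- f^[m] x`, hence interior, and the open map `f^[n - m]` carries a neighbourhood of `w` inside
  -- `Y` onto one of `x`.
  obtain ⟨m, -, hm⟩ := hf.exists_ge_iterate_edist_lt hrec hx hr 0
  obtain ⟨ε, hε, hεY⟩ := EMetric.isOpen_iff.1 isOpen_interior _ (hrY hm)
  obtain ⟨n, hn, hny⟩ := hf.exists_ge_edist_iterate_lt hrec hε m
  obtain ⟨w, hw, hwx⟩ := hsurj' (n - m) x hx
  have hnw : f^[n] w = f^[m] x := by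
    rw [← hwx, ← Function.iterate_add_apply, Nat.add_sub_cancel' hn]
  have hwint : w ∈ interior Y := by
    apply hεY
    change edist w (f^[m] x) < ε
    rw [← hnw, edist_comm]
    exact (hf.edist_iterate_self_le_of_mem_closure_orbit hw n).trans_lt hny
  refine mem_of_superset ((hopen (n - m) _ isOpen_interior).mem_nhds ⟨w, hwint, hwx⟩) ?_
  rintro _ ⟨v, hv, rfl⟩
  exact hinv v (interior_subset hv) _

end Nonexpanding

/-! ### The Poincaré distance and the Schwarz–Pick lemma -/

section Poincare

theorem norm_sub_lt_norm_one_sub_conj_mul {a b : ℂ} (ha : ‖a‖ < 1) (hb : ‖b‖ < 1) :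
    ‖a - b‖ < ‖1 - (starRingEnd ℂ) a * b‖ := by
  have h : ‖1 - (starRingEnd ℂ) a * b‖ ^ 2 - ‖a - b‖ ^ 2 = (1 - ‖a‖ ^ 2) * (1 - ‖b‖ ^ 2) := by
    simp only [← Complex.normSq_eq_norm_sq, Complex.normSq_apply, Complex.sub_re, Complex.sub_im,
      Complex.mul_re, Complex.mul_im, Complex.conj_re, Complex.conj_im, Complex.one_re,
      Complex.one_im]
    ring
  have : 0 < (1 - ‖a‖ ^ 2) * (1 - ‖b‖ ^ 2) := by
    apply mul_pos <;> nlinarith [norm_nonneg a, norm_nonneg b]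
  exact lt_of_pow_lt_pow_left₀ 2 (norm_nonneg _) (by linarith)

/-- The pseudohyperbolic distance of two points of the unit disc is less than `1`. -/
theorem norm_sub_div_norm_one_sub_conj_mul_lt_one {a b : ℂ} (ha : ‖a‖ < 1) (hb : ‖b‖ < 1) :
    ‖a - b‖ / ‖1 - (starRingEnd ℂ) a * b‖ < 1 := by
  have h := norm_sub_lt_norm_one_sub_conj_mul ha hb
  exact (div_lt_one ((norm_nonneg _).trans_lt h)).2 h

theorem poincareDist_nonneg (a b : ℂ) : 0 ≤ poincareDist a b :=
  mul_nonneg zero_le_two (Real.artanh_nonneg (by positivity))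

theorem poincareDist_comm (a b : ℂ) : poincareDist a b = poincareDist b a := by
  have h : ‖1 - (starRingEnd ℂ) a * b‖ = ‖1 - (starRingEnd ℂ) b * a‖ := by
    rw [← RCLike.norm_conj]
    simp [mul_comm]
  rw [poincareDist, poincareDist, h, norm_sub_rev]

theorem poincareDist_zero_left (b : ℂ) : poincareDist 0 b = 2 * Real.artanh ‖b‖ := by
  simp [poincareDist]

theorem le_two_mul_artanh {x : ℝ} (h0 : 0 ≤ x) (h1 : x < 1) : x ≤ 2 * Real.artanh x := by
  rw [Real.artanh_eq_half_log ⟨by linarith, h1.le⟩]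
  have h2 : 0 < (1 + x) / (1 - x) := div_pos (by linarith) (by linarith)
  have h3 := Real.one_sub_inv_le_log_of_pos h2
  have h4 : x ≤ 1 - ((1 + x) / (1 - x))⁻¹ := by
    -- The right side equals `2x / (1 + x)`.
    rw [inv_div, one_sub_div (by linarith), le_div_iff₀ (by linarith)]
    nlinarith
  linarith

/-- On a segment starting at `a`, the Poincaré distance to `a` is largest at the other end. -/
theorem poincareDist_add_smul_le {a b : ℂ} (ha : ‖a‖ < 1) (hb : ‖b‖ < 1) {t : ℝ} (h0 : 0 ≤ t)
    (h1 : t ≤ 1) : poincareDist a (a + t • (b - a)) ≤ poincareDist a b := by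
  have hpos : 0 < ‖1 - (starRingEnd ℂ) a * b‖ :=
    (norm_nonneg _).trans_lt (norm_sub_lt_norm_one_sub_conj_mul ha hb)
  have hc : ‖a + t • (b - a)‖ < 1 := by
    have := (convex_ball (0 : ℂ) 1).add_smul_sub_mem (mem_ball_zero_iff.2 ha)
      (mem_ball_zero_iff.2 hb) ⟨h0, h1⟩
    simpa using this
  have hpos' : 0 < ‖1 - (starRingEnd ℂ) a * (a + t • (b - a))‖ :=
    (norm_nonneg _).trans_lt (norm_sub_lt_norm_one_sub_conj_mul ha hc)
  refine mul_le_mul_of_nonneg_left (Real.artanh_le_artanh ?_ ?_ ?_) zero_le_two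
  · exact lt_of_lt_of_le (by norm_num) (div_nonneg (norm_nonneg _) (norm_nonneg _))
  · exact norm_sub_div_norm_one_sub_conj_mul_lt_one ha hb
  have hn : ‖a - (a + t • (b - a))‖ = t * ‖a - b‖ := by
    rw [show a - (a + t • (b - a)) = t • (a - b) by rw [smul_sub, smul_sub]; ring, norm_smul,
      Real.norm_of_nonneg h0]
  rw [hn, div_le_div_iff₀ hpos' hpos]
  -- The numerator scales by exactly `t`, so only the denominators need comparing. The new one is a
  -- nonnegative real plus `t` times a number of nonnegative real part.
  have hkey : t * ‖1 - (starRingEnd ℂ) a * b‖ ≤ ‖1 - (starRingEnd ℂ) a * (a + t • (b - a))‖ := by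
    have hre : 0 ≤ (1 - (starRingEnd ℂ) a * b).re := by
      have h2 : ((starRingEnd ℂ) a * b).re ≤ ‖a‖ * ‖b‖ := by
        simpa using Complex.re_le_norm ((starRingEnd ℂ) a * b)
      have : ‖a‖ * ‖b‖ ≤ 1 := mul_le_one₀ ha.le (norm_nonneg _) hb.le
      simp only [Complex.sub_re, Complex.one_re]
      linarith
    have hs : 0 ≤ (1 - t) * (1 - ‖a‖ ^ 2) := by
      apply mul_nonneg (by linarith)
      nlinarith [norm_nonneg a]
    have hdec : 1 - (starRingEnd ℂ) a * (a + t • (b - a))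
        = (((1 - t) * (1 - ‖a‖ ^ 2) : ℝ) : ℂ) + t • (1 - (starRingEnd ℂ) a * b) := by
      have : (starRingEnd ℂ) a * a = ((‖a‖ ^ 2 : ℝ) : ℂ) := by
        rw [Complex.conj_mul', Complex.ofReal_pow]
      simp only [Complex.real_smul]
      push_cast at this ⊢
      linear_combination (t - 1 : ℂ) * this
    rw [hdec]
    set s := (1 - t) * (1 - ‖a‖ ^ 2)
    set v := 1 - (starRingEnd ℂ) a * b
    have h3 : ‖t • v‖ ^ 2 ≤ ‖(s : ℂ) + t • v‖ ^ 2 := by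
      simp only [← Complex.normSq_eq_norm_sq, Complex.normSq_apply, Complex.add_re,
        Complex.add_im, Complex.real_smul, Complex.mul_re, Complex.mul_im, Complex.ofReal_re,
        Complex.ofReal_im]
      nlinarith [mul_nonneg hs (mul_nonneg h0 hre), sq_nonneg s]
    have h4 : ‖t • v‖ = t * ‖v‖ := by rw [norm_smul, Real.norm_of_nonneg h0]
    rw [← h4]
    exact le_of_sq_le_sq h3 (norm_nonneg _)
  nlinarith [mul_le_mul_of_nonneg_left hkey (norm_nonneg (a - b))]

/-- **Schwarz–Pick lemma** for maps of the unit disc into a ball, with a crude constant. -/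
theorem dist_le_mul_poincareDist {E : Type*} [NormedAddCommGroup E] [NormedSpace ℂ E]
    {φ : ℂ → E} (hφ : DifferentiableOn ℂ φ (Metric.ball 0 1)) {R : ℝ}
    (hR : MapsTo φ (Metric.ball 0 1) (Metric.closedBall 0 R)) {a b : ℂ} (ha : ‖a‖ < 1)
    (hb : ‖b‖ < 1) : dist (φ a) (φ b) ≤ 2 * R * poincareDist a b := by
  have hden : ∀ ζ : ℂ, ‖ζ‖ < 1 → 1 + (starRingEnd ℂ) a * ζ ≠ 0 := by
    intro ζ hζ h
    have h2 := norm_sub_lt_norm_one_sub_conj_mul ha (b := -ζ) (by simpa using hζ)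
    rw [show 1 - (starRingEnd ℂ) a * -ζ = 0 by linear_combination h, norm_zero] at h2
    exact (norm_nonneg _).not_gt h2
  have hM : MapsTo (fun ζ : ℂ => (ζ + a) / (1 + (starRingEnd ℂ) a * ζ)) (Metric.ball 0 1)
      (Metric.ball 0 1) := by
    intro ζ hζ
    rw [mem_ball_zero_iff] at hζ ⊢
    have h2 := norm_sub_div_norm_one_sub_conj_mul_lt_one ha (b := -ζ) (by simpa using hζ)
    rw [norm_div]
    simpa [add_comm] using h2
  have hMd : DifferentiableOn ℂ (fun ζ : ℂ => (ζ + a) / (1 + (starRingEnd ℂ) a * ζ))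
      (Metric.ball 0 1) := by
    refine DifferentiableOn.div (by fun_prop) (by fun_prop) fun ζ hζ => ?_
    exact hden ζ (by simpa using hζ)
  have hd := hφ.comp hMd hM
  -- Precomposing with a disc automorphism taking `0` to `a` and `c` to `b` reduces to the Schwarz
  -- lemma at the origin; recentring the target ball at `φ a` doubles the radius.
  set ψ := φ ∘ fun ζ : ℂ => (ζ + a) / (1 + (starRingEnd ℂ) a * ζ) with hψ
  have hψ0 : ψ 0 = φ a := by simp [hψ]
  have hmaps : MapsTo ψ (Metric.ball 0 1) (Metric.closedBall (ψ 0) (2 * R)) := by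
    intro ζ hζ
    have h1 : ‖ψ ζ‖ ≤ R := mem_closedBall_zero_iff.1 (hR (hM hζ))
    have h2 := mem_closedBall_zero_iff.1 (hR (mem_ball_zero_iff.2 ha))
    rw [mem_closedBall_iff_norm, hψ0]
    exact (norm_sub_le _ _).trans (by linarith)
  have hne : 1 - (starRingEnd ℂ) a * b ≠ 0 := by
    simpa [sub_eq_add_neg] using hden (-b) (by simpa using hb)
  set c := (b - a) / (1 - (starRingEnd ℂ) a * b) with hc
  have hcn : ‖c‖ = ‖a - b‖ / ‖1 - (starRingEnd ℂ) a * b‖ := by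
    rw [hc, norm_div, norm_sub_rev]
  have hc1 : ‖c‖ < 1 := hcn ▸ norm_sub_div_norm_one_sub_conj_mul_lt_one ha hb
  have hψc : ψ c = φ b := by
    have h3 := hden c hc1
    simp only [hψ, Function.comp_apply]
    congr 1
    have hcm : c * (1 - (starRingEnd ℂ) a * b) = b - a := div_mul_cancel₀ _ hne
    rw [div_eq_iff h3]
    linear_combination hcm
  have hS := Complex.dist_le_div_mul_dist_of_mapsTo_ball hd hmaps (mem_ball_zero_iff.2 hc1)
  rw [hψ0, hψc, dist_zero_right, div_one, dist_comm] at hS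
  refine hS.trans (mul_le_mul_of_nonneg_left ?_ ?_)
  · rw [poincareDist, ← hcn]
    exact le_two_mul_artanh (norm_nonneg _) hc1
  · have := norm_nonneg (φ a)
    have h2 := mem_closedBall_zero_iff.1 (hR (mem_ball_zero_iff.2 ha))
    linarith

end Poincare

/-! ### Chains of holomorphic discs -/

namespace KobayashiChain

variable {k : ℕ} {U V : Set (Ck k)} {z w v : Ck k} {l l' : ℝ}

theorem nonneg (h : KobayashiChain U z w l) : 0 ≤ l := by
  induction h with
  | nil => exact le_rfl
  | cons φ hφ hφU a b ha hb w l h ih => exact add_nonneg (poincareDist_nonneg a b) ih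

theorem trans (h : KobayashiChain U z w l) (h' : KobayashiChain U w v l') :
    KobayashiChain U z v (l + l') := by
  induction h with
  | nil => simpa using h'
  | cons φ hφ hφU a b ha hb w l h ih =>
    rw [add_assoc]
    exact cons φ hφ hφU a b ha hb v _ (ih h')

theorem single {φ : ℂ → Ck k} (hφ : DifferentiableOn ℂ φ (Metric.ball 0 1))
    (hφU : MapsTo φ (Metric.ball 0 1) U) {a b : ℂ} (ha : a ∈ Metric.ball (0 : ℂ) 1)
    (hb : b ∈ Metric.ball (0 : ℂ) 1) : KobayashiChain U (φ a) (φ b) (poincareDist a b) := by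
  simpa using cons φ hφ hφU a b ha hb _ 0 (nil _ (hφU hb))

theorem symm (h : KobayashiChain U z w l) : KobayashiChain U w z l := by
  induction h with
  | nil z hz => exact nil z hz
  | cons φ hφ hφU a b ha hb w l h ih =>
    rw [add_comm, poincareDist_comm]
    exact ih.trans (single hφ hφU hb ha)

theorem map {f : Ck k → Ck k} (hf : DifferentiableOn ℂ f U) (hfV : MapsTo f U V)
    (h : KobayashiChain U z w l) : KobayashiChain V (f z) (f w) l := by
  induction h with
  | nil z hz => exact nil _ (hfV hz)
  | cons φ hφ hφU a b ha hb w l h ih =>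
    exact cons (f ∘ φ) (hf.comp hφ hφU) (hfV.comp hφU) a b ha hb _ l ih

/-- A chain of discs that leaves a ball passes through the bounding sphere. -/
theorem exists_mem_sphere {y : Ck k} {ε : ℝ} (h : KobayashiChain U z w l) (hz : dist z y < ε)
    (hw : ε ≤ dist w y) :
    ∃ s ∈ Metric.sphere y ε, ∃ l' ≤ l, KobayashiChain U z s l' := by
  induction h with
  | nil => exact absurd hz hw.not_gt
  | cons φ hφ hφU a b ha hb w l h ih =>
    rcases lt_or_ge (dist (φ b) y) ε with hlt | hge
    · obtain ⟨s, hs, l', hl', hc⟩ := ih hlt hw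
      exact ⟨s, hs, _, by gcongr, cons φ hφ hφU a b ha hb s l' hc⟩
    · have hseg : MapsTo (fun t : ℝ => a + t • (b - a)) (Icc 0 1) (Metric.ball 0 1) :=
        fun t ht => (convex_ball (0 : ℂ) 1).add_smul_sub_mem ha hb ht
      have hcont : ContinuousOn (fun t : ℝ => dist (φ (a + t • (b - a))) y) (Icc 0 1) :=
        continuous_id.dist continuous_const |>.comp_continuousOn
          (hφ.continuousOn.comp (by fun_prop) hseg)
      obtain ⟨t, ht, hts⟩ := intermediate_value_Icc zero_le_one hcont
        (show ε ∈ Icc _ _ from ⟨by simpa using hz.le, by simpa using hge⟩)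
      refine ⟨_, hts, _, ?_, single hφ hφU ha (hseg ht)⟩
      have := poincareDist_add_smul_le (mem_ball_zero_iff.1 ha) (mem_ball_zero_iff.1 hb) ht.1 ht.2
      linarith [h.nonneg]

theorem dist_le {R : ℝ} (hR : U ⊆ Metric.closedBall 0 R) (h : KobayashiChain U z w l) :
    dist z w ≤ 2 * R * l := by
  induction h with
  | nil => simp
  | cons φ hφ hφU a b ha hb w l h ih =>
    have := dist_le_mul_poincareDist hφ (fun _ hx => hR (hφU hx)) (mem_ball_zero_iff.1 ha)
      (mem_ball_zero_iff.1 hb)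
    linarith [dist_triangle (φ a) (φ b) w]

end KobayashiChain

/-! ### The Kobayashi distance and its topology -/

section KobayashiEDist

variable {k : ℕ} {U V : Set (Ck k)}

theorem KobayashiChain.kobayashiEDist_le {z w : Ck k} {l : ℝ} (h : KobayashiChain U z w l) :
    kobayashiEDist U z w ≤ ENNReal.ofReal l :=
  iInf₂_le l h

theorem exists_chain_of_kobayashiEDist_lt {z w : Ck k} {c : ENNReal}
    (h : kobayashiEDist U z w < c) : ∃ l, KobayashiChain U z w l ∧ ENNReal.ofReal l < c := by
  simpa only [kobayashiEDist, iInf_lt_iff, exists_prop] using h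

theorem kobayashiEDist_self {z : Ck k} (hz : z ∈ U) : kobayashiEDist U z z = 0 := by
  simpa using (KobayashiChain.nil z hz).kobayashiEDist_le

theorem kobayashiEDist_comm (z w : Ck k) : kobayashiEDist U z w = kobayashiEDist U w z :=
  le_antisymm (le_iInf₂ fun _ h => h.symm.kobayashiEDist_le)
    (le_iInf₂ fun _ h => h.symm.kobayashiEDist_le)

theorem kobayashiEDist_triangle (z w v : Ck k) :
    kobayashiEDist U z v ≤ kobayashiEDist U z w + kobayashiEDist U w v := by
  rw [kobayashiEDist.eq_def U z w, kobayashiEDist.eq_def U w v]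
  simp only [ENNReal.iInf_add, ENNReal.add_iInf]
  refine le_iInf₂ fun l h => le_iInf₂ fun l' h' => ?_
  exact (h'.trans h).kobayashiEDist_le.trans ENNReal.ofReal_add_le

theorem kobayashiEDist_map_le {f : Ck k → Ck k} (hf : DifferentiableOn ℂ f U)
    (hfV : MapsTo f U V) (z w : Ck k) :
    kobayashiEDist V (f z) (f w) ≤ kobayashiEDist U z w :=
  le_iInf₂ fun _ h => (h.map hf hfV).kobayashiEDist_le

theorem kobayashiEDist_anti (hVU : V ⊆ U) (z w : Ck k) :
    kobayashiEDist U z w ≤ kobayashiEDist V z w :=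
  kobayashiEDist_map_le differentiableOn_id hVU z w

/-- Tested on the single affine disc of radius `r` centred at `y` in the direction of `z`. -/
theorem kobayashiEDist_le_artanh {y z : Ck k} {r : ℝ} (hr : Metric.ball y r ⊆ U)
    (hz : z ∈ Metric.ball y r) :
    kobayashiEDist U y z ≤ ENNReal.ofReal (2 * Real.artanh (dist z y / r)) := by
  have hr0 : 0 < r := Metric.pos_of_mem_ball hz
  rcases eq_or_ne z y with rfl | hne
  · rw [kobayashiEDist_self (hr hz)]; exact zero_le
  have hd : 0 < dist z y := dist_pos.2 hne
  have hdr : dist z y / r < 1 := (div_lt_one hr0).2 hz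
  set φ : ℂ → Ck k := fun ζ => y + (ζ * (r / dist z y : ℝ)) • (z - y)
  have hφ : DifferentiableOn ℂ φ (Metric.ball 0 1) := by fun_prop
  have hφU : MapsTo φ (Metric.ball 0 1) U := by
    intro ζ hζ
    apply hr
    rw [mem_ball_zero_iff] at hζ
    rw [mem_ball_iff_norm]
    simp only [φ, add_sub_cancel_left, norm_smul, norm_mul, Complex.norm_real, ← dist_eq_norm]
    rw [Real.norm_of_nonneg (by positivity), mul_assoc, div_mul_cancel₀ _ hd.ne']
    nlinarith
  have hb : ((dist z y / r : ℝ) : ℂ) ∈ Metric.ball (0 : ℂ) 1 := by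
    rw [mem_ball_zero_iff, Complex.norm_real, Real.norm_of_nonneg (by positivity)]
    exact hdr
  have h := (KobayashiChain.single hφ hφU (Metric.mem_ball_self one_pos) hb).kobayashiEDist_le
  have h0 : φ 0 = y := by simp [φ]
  have h1 : φ (dist z y / r : ℝ) = z := by
    simp only [φ]
    rw [← Complex.ofReal_mul, div_mul_div_cancel₀ hr0.ne', div_self hd.ne']
    simp
  rwa [h0, h1, poincareDist_zero_left, Complex.norm_real,
    Real.norm_of_nonneg (by positivity)] at h

theorem Real.continuousAt_artanh_zero : ContinuousAt Real.artanh 0 := by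
  unfold Real.artanh
  refine ContinuousAt.log (ContinuousAt.sqrt (ContinuousAt.div (by fun_prop) (by fun_prop) ?_)) ?_
    <;> norm_num

/-- The Kobayashi pseudodistance to `y` tends to `0` at `y`. -/
theorem tendsto_kobayashiEDist (hU : IsOpen U) {y : Ck k} (hy : y ∈ U) :
    Tendsto (kobayashiEDist U y) (𝓝 y) (𝓝 0) := by
  obtain ⟨r, hr, hrU⟩ := Metric.isOpen_iff.1 hU y hy
  have h1 : Tendsto (fun z => ENNReal.ofReal (2 * Real.artanh (dist z y / r))) (𝓝 y) (𝓝 0) := by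
    have h2 : Tendsto (fun z : Ck k => dist z y / r) (𝓝 y) (𝓝 0) := by
      have : Continuous fun z : Ck k => dist z y / r := by fun_prop
      simpa using this.tendsto y
    have h3 := (Real.continuousAt_artanh_zero.tendsto.comp h2).const_mul 2
    simpa using ENNReal.tendsto_ofReal h3
  refine tendsto_of_tendsto_of_tendsto_of_le_of_le' tendsto_const_nhds h1
    (Eventually.of_forall fun _ => zero_le) ?_
  filter_upwards [Metric.ball_mem_nhds y hr] with z hz using kobayashiEDist_le_artanh hrU hz

/-- Used to attain a minimum on compact spheres. -/
theorem lowerSemicontinuousOn_kobayashiEDist (hU : IsOpen U) (y : Ck k) :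
    LowerSemicontinuousOn (kobayashiEDist U y) U := by
  intro s hs c hc
  obtain ⟨δ, hδ, hcδ⟩ := ENNReal.lt_iff_exists_add_pos_lt.1 hc
  have h := (tendsto_kobayashiEDist hU hs).eventually
    (gt_mem_nhds (ENNReal.coe_pos.2 hδ))
  filter_upwards [nhdsWithin_le_nhds h] with s' hs'
  by_contra! hle
  refine hcδ.not_ge ((kobayashiEDist_triangle y s' s).trans ?_)
  rw [kobayashiEDist_comm s' s]
  gcongr

/-- The Kobayashi distance of a hyperbolic open set controls the Euclidean distance locally. -/
theorem IsKobayashiHyperbolic.exists_kobayashiEDist_lt_imp_dist_lt (hh : IsKobayashiHyperbolic U)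
    (hU : IsOpen U) {y : Ck k} (hy : y ∈ U) {ε : ℝ} (hε : 0 < ε) :
    ∃ δ > 0, ∀ z, kobayashiEDist U y z < δ → dist z y < ε := by
  obtain ⟨r, hr, hrU⟩ := Metric.nhds_basis_closedBall.mem_iff.1 (hU.mem_nhds hy)
  set e := min ε r
  have he : 0 < e := lt_min hε hr
  have hsU : Metric.sphere y e ⊆ U := fun s hs =>
    hrU (Metric.mem_closedBall.2 ((Metric.mem_sphere.1 hs).le.trans (min_le_right _ _)))
  -- The minimum over the sphere is positive by hyperbolicity, and any chain leaving the ball must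
  -- cross the sphere. The sphere can be empty when `k = 0`.
  obtain ⟨δ, hδ, hδs⟩ : ∃ δ > 0, ∀ s ∈ Metric.sphere y e, δ ≤ kobayashiEDist U y s := by
    rcases (Metric.sphere y e).eq_empty_or_nonempty with hemp | hne
    · exact ⟨1, one_pos, by simp [hemp]⟩
    obtain ⟨s, hs, hmin⟩ := ((lowerSemicontinuousOn_kobayashiEDist hU y).mono hsU).exists_isMinOn
      hne (isCompact_sphere y e)
    refine ⟨kobayashiEDist U y s, pos_iff_ne_zero.2 fun h0 => ?_, fun s' hs' => hmin hs'⟩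
    have := hh y hy s (hsU hs) h0
    rw [← this, mem_sphere_iff_norm, sub_self, norm_zero] at hs
    exact he.ne hs
  refine ⟨δ, hδ, fun z hz => ?_⟩
  by_contra! hge
  obtain ⟨l, hl, hlδ⟩ := exists_chain_of_kobayashiEDist_lt hz
  obtain ⟨s, hs, l', hl', hc⟩ := hl.exists_mem_sphere (y := y) (ε := e) (by simpa using he)
    ((min_le_left _ _).trans hge)
  exact (hδs s hs).not_gt ((hc.kobayashiEDist_le.trans (ENNReal.ofReal_le_ofReal hl')).trans_lt hlδ)

theorem IsKobayashiHyperbolic.mono (hh : IsKobayashiHyperbolic U) (hVU : V ⊆ U) :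
    IsKobayashiHyperbolic V := fun z hz w hw h =>
  hh z (hVU hz) w (hVU hw) (nonpos_iff_eq_zero.1 (h ▸ kobayashiEDist_anti hVU z w))

theorem Bornology.IsBounded.isKobayashiHyperbolic (hb : Bornology.IsBounded U) :
    IsKobayashiHyperbolic U := by
  obtain ⟨R, hR0, hR⟩ := hb.subset_closedBall_lt 0 0
  intro z _ w _ h
  by_contra hne
  have hd : 0 < dist z w := dist_pos.2 hne
  have hpos : 0 < ENNReal.ofReal (dist z w / (2 * R)) := ENNReal.ofReal_pos.2 (by positivity)
  obtain ⟨l, hl, hlt⟩ := exists_chain_of_kobayashiEDist_lt (h.trans_lt hpos)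
  have h1 := hl.dist_le hR
  have h2 := (ENNReal.ofReal_lt_ofReal_iff (by positivity)).1 hlt
  rw [lt_div_iff₀ (by positivity)] at h2
  linarith

/-- The Kobayashi distance of a hyperbolic open set induces its topology. -/
theorem IsKobayashiHyperbolic.hasBasis_nhds (hh : IsKobayashiHyperbolic U) (hU : IsOpen U)
    (y : U) : (𝓝 y).HasBasis (fun c : ENNReal => 0 < c)
      (fun c => {z : U | kobayashiEDist U (y : Ck k) z < c}) := by
  refine ⟨fun t => ⟨fun ht => ?_, ?_⟩⟩
  · obtain ⟨ε, hε, hεt⟩ := Metric.mem_nhds_iff.1 ht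
    obtain ⟨δ, hδ, h⟩ := hh.exists_kobayashiEDist_lt_imp_dist_lt hU y.2 hε
    exact ⟨δ, hδ, fun z hz => hεt (h z hz)⟩
  · rintro ⟨c, hc, hct⟩
    refine mem_of_superset ?_ hct
    exact ((tendsto_kobayashiEDist hU y.2).comp continuous_subtype_val.continuousAt).eventually
      (gt_mem_nhds hc)

/-- The extended metric of a hyperbolic open set given by its Kobayashi distance. -/
@[reducible] noncomputable def IsKobayashiHyperbolic.pseudoEMetricSpace
    (hh : IsKobayashiHyperbolic U) (hU : IsOpen U) : PseudoEMetricSpace U :=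
  PseudoEMetricSpace.ofEDistOfTopology (fun z w : U => kobayashiEDist U (z : Ck k) w)
    (fun z => kobayashiEDist_self z.2) (fun _ _ => kobayashiEDist_comm _ _)
    (fun _ _ _ => kobayashiEDist_triangle _ _ _) (hh.hasBasis_nhds hU)

end KobayashiEDist

/-! ### Dense orbits and the contradiction -/

section Main

variable {k : ℕ} {U C : Set (Ck k)} {f : Ck k → Ck k}

/-- A holomorphic open self-map of a nonempty hyperbolic open set in `ℂ^k`, `k ≥ 1`, has no point
whose orbit closure is a neighbourhood of the point. -/
theorem IsKobayashiHyperbolic.not_mem_nhds_of_orbit {V : Set (Ck k)} (hk : 1 ≤ k)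
    (hh : IsKobayashiHyperbolic V) (hV : IsOpen V) (hf : DifferentiableOn ℂ f V)
    (hfV : MapsTo f V V) (hfo : ∀ O ⊆ V, IsOpen O → IsOpen (f '' O)) {y : Ck k} (hy : y ∈ V) :
    closure (range fun n => f^[n] y) ∉ 𝓝 y := by
  intro hnhds
  have : NeZero k := ⟨by omega⟩
  set g : V → V := hfV.restrict
  have hg : ∀ n (v : V), ((g^[n] v : V) : Ck k) = f^[n] v := by
    intro n
    induction n with
    | zero => exact fun v => rfl
    | succ n ih => exact fun v => by rw [Function.iterate_succ_apply, ih]; rfl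
  have hgo : IsOpenMap g := by
    intro O hO
    rw [hV.isOpenEmbedding_subtypeVal.isOpen_iff_image_isOpen]
    have : Subtype.val '' (g '' O) = f '' (Subtype.val '' O) := by
      simp only [image_image]; rfl
    rw [this]
    exact hfo _ (Subtype.coe_image_subset _ _) (hV.isOpenMap_subtype_val O hO)
  have hcl : ∀ v w : V, (v ∈ closure (range fun n => g^[n] w)) ↔
      (v : Ck k) ∈ closure (range fun n => f^[n] (w : Ck k)) := by
    intro v w
    rw [closure_subtype, ← range_comp]
    simp only [Function.comp_def, hg]
  have hint : (⟨y, hy⟩ : V) ∈ interior (closure (range fun n => g^[n] ⟨y, hy⟩)) := by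
    rw [mem_interior_iff_mem_nhds]
    filter_upwards [continuous_subtype_val.continuousAt.preimage_mem_nhds hnhds] with v hv
    exact (hcl _ _).2 hv
  have hrec : (⟨y, hy⟩ : V) ∈ closure (range fun n => g^[n] (g ⟨y, hy⟩)) := by
    rw [hcl]
    exact isOpen_subset_closure_range_shift isOpen_interior interior_subset 1
      (mem_interior_iff_mem_nhds.2 hnhds)
  have hLc : LocallyCompactSpace V := hV.locallyCompactSpace
  -- This metric is built over the subspace topology, so the topological facts above still apply.
  let _ := hh.pseudoEMetricSpace hV
  have hlip : LipschitzWith 1 g := by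
    intro v w
    rw [ENNReal.coe_one, one_mul]
    exact kobayashiEDist_map_le hf hfV (v : Ck k) w
  have hc := (hlip.isCompact_closure_orbit hrec).image continuous_subtype_val
  have ho := hV.isOpenMap_subtype_val _ (hlip.isOpen_closure_orbit hgo hrec hint)
  have huniv := IsClopen.eq_univ ⟨hc.isClosed, ho⟩
    ⟨y, mem_image_of_mem _ (interior_subset hint)⟩
  rw [huniv] at hc
  exact noncompact_univ (Ck k) hc

/-- If the relative closure of `C` is a countable union of closed invariant sets with dense
orbits, then it has no interior points. -/
theorem interior_relClosure_eq_empty (hk : 1 ≤ k)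
    (hh : IsKobayashiHyperbolic U) (hf : DifferentiableOn ℂ f U)
    (hfo : ∀ O : Set (Ck k), O ⊆ U → IsOpen O → IsOpen (f '' O))
    {𝒮 : Set (Set (Ck k))} (hcount : 𝒮.Countable)
    (hS : ∀ S ∈ 𝒮, IsClosedInvariantWithDenseOrbit U f S) (hC : relClosure U C = ⋃₀ 𝒮) :
    interior (relClosure U C) = ∅ := by
  have : NeZero k := ⟨by omega⟩
  set V := interior (relClosure U C) with hVdef
  have hV : IsOpen V := isOpen_interior
  have hVU : V ⊆ U := interior_subset.trans inter_subset_right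
  have hmaps : MapsTo f (relClosure U C) (relClosure U C) := by
    rw [hC]
    rintro z ⟨S, hS', hz⟩
    exact ⟨S, hS', (hS S hS').mapsTo hz⟩
  -- Openness of `f` makes `f '' V` an open subset of the relative closure.
  have hfV : MapsTo f V V := by
    rw [mapsTo_iff_image_subset]
    exact interior_maximal ((image_mono interior_subset).trans hmaps.image_subset)
      (hfo V hVU hV)
  by_contra hne
  obtain ⟨p, hp⟩ := nonempty_iff_ne_empty.2 hne
  have : Nonempty V := ⟨⟨p, hp⟩⟩
  have : Countable 𝒮 := hcount.to_subtype
  have : LocallyCompactSpace V := hV.locallyCompactSpace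
  have hclosed : ∀ S : 𝒮, IsClosed (Subtype.val ⁻¹' (S : Set (Ck k)) : Set V) := by
    intro S
    have h1 : (Subtype.val ⁻¹' (S : Set (Ck k)) : Set V)
        = Subtype.val ⁻¹' closure (S : Set (Ck k)) := by
      ext v
      have h2 := (hS S S.2).relClosure_eq
      exact ⟨fun h => subset_closure h, fun h => h2.subset ⟨h, hVU v.2⟩⟩
    rw [h1]
    exact isClosed_closure.preimage continuous_subtype_val
  -- Baire category in the locally compact space `V`.
  obtain ⟨S, v, hv⟩ := nonempty_interior_of_iUnion_of_closed hclosed (by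
    refine eq_univ_of_forall fun v => ?_
    obtain ⟨S, hS', hz⟩ := hC.subset (interior_subset v.2)
    exact mem_iUnion.2 ⟨⟨S, hS'⟩, hz⟩)
  set O : Set (Ck k) := Subtype.val '' interior (Subtype.val ⁻¹' (S : Set (Ck k)) : Set V)
  have hO : IsOpen O := hV.isOpenMap_subtype_val _ isOpen_interior
  have hOS : O ⊆ S := by
    rintro _ ⟨w, hw, rfl⟩
    exact mem_preimage.1 (interior_subset hw)
  obtain ⟨x, hx, hxS⟩ := (hS S S.2).dense_orbit
  obtain ⟨_, hyO, n, rfl⟩ := mem_closure_iff.1 (hxS (hOS (mem_image_of_mem _ hv))) O hO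
    (mem_image_of_mem _ hv)
  have hyV : f^[n] x ∈ V := Subtype.coe_image_subset _ _ hyO
  refine (hh.mono hVU).not_mem_nhds_of_orbit hk hV (hf.mono hVU) hfV
    (fun O' hO' => hfo O' (hO'.trans hVU)) hyV (mem_of_superset (hO.mem_nhds hyO) ?_)
  simpa only [Function.iterate_add_apply] using
    isOpen_subset_closure_range_shift hO (hOS.trans hxS) n

end Main

/-- Under the hypotheses the interior of the relative closure of `C` is even empty: an orbit that is
dense in an open set would, `f` being nonexpanding for the Kobayashi distance, have a closure that
is compact and open in `ℂ^k`. The invariance of `C` and the barriers are not needed for this. -/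
theorem corollary3p6 (k : ℕ) (hk : 1 ≤ k) (U : Set (Ck k)) (hUo : IsOpen U)
    (hUc : IsConnected U) (hUb : Bornology.IsBounded U ∨ IsKobayashiHyperbolic U)
    (f : Ck k → Ck k) (hf : DifferentiableOn ℂ f U)
    (hfo : ∀ O : Set (Ck k), O ⊆ U → IsOpen O → IsOpen (f '' O))
    (hbar : ∀ q ∈ frontier U, HasPSHBarrier U q)
    (C : Set (Ck k)) (hCU : C ⊆ U) (hC : MapsTo f C C)
    (h : IsClosedInvariantWithDenseOrbit U f (relClosure U C) ∨
      ∃ 𝒮 : Set (Set (Ck k)), 𝒮.Countable ∧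
        (∀ S ∈ 𝒮, IsClosedInvariantWithDenseOrbit U f S) ∧ relClosure U C = ⋃₀ 𝒮) :
    ∀ p ∈ interior (relClosure U C),
      ¬ IsRecurrentPoint f p ∧
      ¬ IsWeaklyRecurrentIn f (connectedComponentIn (interior (relClosure U C)) p) p := by
  obtain ⟨𝒮, hcount, hS, hU⟩ : ∃ 𝒮 : Set (Set (Ck k)), 𝒮.Countable ∧
      (∀ S ∈ 𝒮, IsClosedInvariantWithDenseOrbit U f S) ∧ relClosure U C = ⋃₀ 𝒮 := by
    rcases h with h | h
    · exact ⟨{relClosure U C}, countable_singleton _, by simpa using h, by simp⟩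
    · exact h
  have hh : IsKobayashiHyperbolic U := hUb.elim (fun hb => hb.isKobayashiHyperbolic) id
  intro p hp
  rw [interior_relClosure_eq_empty hk hh hf hfo hcount hS hU] at hp
  exact absurd hp (notMem_empty p)
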